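/- Let $N\ge 2$ be an integer, $f:\mathbb R\to\mathbb R$ locally Lipschitz, $I=(0,1)$, and $T>0$, $K\ge 0$, $C_0>0$, $\beta>0$. **Continuous problem.** Let $u^0\in C([0,1])$ and let $u:[0,1]\times[0,T]\to\mathbb R$ satisfy $$u_t=u_{xx}+\tfrac{N-1}{x}u_x+f(u)\ \ (0<x<1,\ 0<t\le T),\qquad u_x(0,t)=u(1,t)=0\ \ (0<t\le T),\qquad u(x,0)=u^0(x)\ \ (x\in I).$$ Assume that $u$ is smooth in the sense that all the derivatives in $$\kappa(u)=\sum_{k=0}^{2}\|\partial_x^k u\|_{L^\infty(Q_T)}+\sum_{l=1}^{2}\|\partial_t^l u\|_{L^\infty(Q_T)}+\sum_{k=1}^{2}\|\partial_t\partial_x^k u\|_{L^\infty(Q_T)}$$ exist and are continuous on $Q_T=[0,1]\times[0,T]$, and that $\kappa(u)\le K$. **Discretization.** Let $0=x_0<x_1<\dots<x_m=1$ ($m\ge1$), $h_j=x_j-x_{j-1}$, $h=\max_j h_j$, and assume $h\le\beta\min_j h_j$. Let $S_h$ be the space of continuous functions on $[0,1]$ that are affine on each $[x_{j-1},x_j]$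 and vanish at $x=1$, with nodal basis $\phi_0,\dots,\phi_{m-1}$, $\phi_i(x_j)=\delta_{ij}$. Put $$(w,v)=\int_0^1x^{N-1}wv\,dx,\qquad A(w,v)=\int_0^1x^{N-1}w_xv_x\,dx,\qquad \langle w,v\rangle=\sum_{i=0}^{m-1}w(x_i)v(x_i)(1,\phi_i).$$ Let $\tau_0,\tau_1,\dots>0$ be time increments with $\tau=\sup_{j\ge0}\tau_j<\infty$, and $t_n=\sum_{j<n}\tau_j$. Assume the time-step restriction $$\tau\le\min_{0\le i\le m-1}\frac{(1,\phi_i)}{A(\phi_i,\phi_i)}.$$ Let $u_h^n\in S_h$ ($n\ge0$) be the solution of the explicit mass-lumped scheme (ML–2) $$\Big\langle\frac{u_h^{n+1}-u_h^n}{\tau_n},\chi\Big\rangle+A(u_h^n,\chi)=\langle f(u_h^n),\chi\rangle\qquad(\chi\in S_h,\ n\ge0),$$ with an initial value $u_h^0\in S_h$ such that $\|u_h^0-u^0\|_{L^\infty(I)}\le C_0h^2$. **Theorem 2.6.** There are constants $C,h_*,\tau_*>0$, depending only on $T,f,K,C_0,N,\beta$ (in particular not on $u$, the mesh or the time increments),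 such that, whenever all of the above holds with $h\le h_*$ and $\tau\le\tau_*$, $$\sup_{0\le t_n\le T}\|u_h^n-u(\cdot,t_n)\|_{L^\infty(I)}\le C(h+\tau).$$ -/

import Mathlib

open scoped ENNReal NNReal

noncomputable section

namespace RadialFEM

/-! ### Norms, derivatives and the continuous problem -/

/-- The sup norm of `v` on the set `s`, with values in `[0, ∞]`. -/
def supNorm {α : Type*} (s : Set α) (v : α → ℝ) : ℝ≥0∞ := ⨆ y ∈ s, ‖v y‖ₑ

/-- The closed space-time cylinder `[0,1] × [0,T]`. -/
def cylinder (T : ℝ) : Set (ℝ × ℝ) := Set.Icc (0 : ℝ) 1 ×ˢ Set.Icc (0 : ℝ) T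

/-- The partial derivative `∂ₓᵏ u (x,t)` on `[0,1]` (one-sided at the end points). -/
def partialX (k : ℕ) (u : ℝ → ℝ → ℝ) (x t : ℝ) : ℝ :=
  iteratedDerivWithin k (fun y => u y t) (Set.Icc (0 : ℝ) 1) x

/-- The partial derivative `∂ₜˡ u (x,t)` on `[0,T]` (one-sided at the end points). -/
def partialT (T : ℝ) (l : ℕ) (u : ℝ → ℝ → ℝ) (x t : ℝ) : ℝ :=
  iteratedDerivWithin l (fun s => u x s) (Set.Icc (0 : ℝ) T) t

/-- The mixed partial derivative `∂ₜ ∂ₓᵏ u (x,t)` on the cylinder. -/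
def partialTX (T : ℝ) (k : ℕ) (u : ℝ → ℝ → ℝ) (x t : ℝ) : ℝ :=
  derivWithin (fun s => partialX k u x s) (Set.Icc (0 : ℝ) T) t

/-- All the derivatives that enter `kappa` exist and are continuous on `[0,1] × [0,T]`. -/
structure IsSmooth (T : ℝ) (u : ℝ → ℝ → ℝ) : Prop where
  contDiff_x : ∀ t ∈ Set.Icc (0 : ℝ) T, ContDiffOn ℝ 2 (fun x => u x t) (Set.Icc 0 1)
  contDiff_t : ∀ x ∈ Set.Icc (0 : ℝ) 1, ContDiffOn ℝ 2 (fun t => u x t) (Set.Icc 0 T)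
  diff_tx : ∀ k ∈ Finset.Icc 1 2, ∀ x ∈ Set.Icc (0 : ℝ) 1,
    DifferentiableOn ℝ (fun t => partialX k u x t) (Set.Icc 0 T)
  cont_x : ∀ k ∈ Finset.Icc 0 2,
    ContinuousOn (fun p : ℝ × ℝ => partialX k u p.1 p.2) (cylinder T)
  cont_t : ∀ l ∈ Finset.Icc 1 2,
    ContinuousOn (fun p : ℝ × ℝ => partialT T l u p.1 p.2) (cylinder T)
  cont_tx : ∀ k ∈ Finset.Icc 1 2,
    ContinuousOn (fun p : ℝ × ℝ => partialTX T k u p.1 p.2) (cylinder T)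

/-- The quantity `κ(u)`: the sum of the sup norms on `[0,1] × [0,T]` of `∂ₓᵏ u` (`0 ≤ k ≤ 2`),
`∂ₜˡ u` (`1 ≤ l ≤ 2`) and `∂ₜ ∂ₓᵏ u` (`1 ≤ k ≤ 2`). -/
def kappa (T : ℝ) (u : ℝ → ℝ → ℝ) : ℝ≥0∞ :=
  (∑ k ∈ Finset.Icc 0 2, supNorm (cylinder T) (fun p => partialX k u p.1 p.2)) +
  (∑ l ∈ Finset.Icc 1 2, supNorm (cylinder T) (fun p => partialT T l u p.1 p.2)) +
  (∑ k ∈ Finset.Icc 1 2, supNorm (cylinder T) (fun p => partialTX T k u p.1 p.2))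

/-- `u` solves, up to time `T`, the radial semilinear heat equation
`u_t = u_xx + (N-1)/x u_x + f(u)` for `0 < x < 1`, with `u_x(0,t) = u(1,t) = 0` and
`u(x,0) = u⁰(x)`. -/
structure IsSolution (N : ℕ) (f : ℝ → ℝ) (T : ℝ) (u₀ : ℝ → ℝ) (u : ℝ → ℝ → ℝ) : Prop where
  equation : ∀ x ∈ Set.Ioo (0 : ℝ) 1, ∀ t ∈ Set.Ioc (0 : ℝ) T,
    partialT T 1 u x t = partialX 2 u x t + ((N : ℝ) - 1) / x * partialX 1 u x t + f (u x t)
  boundary_zero : ∀ t ∈ Set.Ioc (0 : ℝ) T, partialX 1 u 0 t = 0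
  boundary_one : ∀ t ∈ Set.Ioc (0 : ℝ) T, u 1 t = 0
  initial : ∀ x ∈ Set.Ioo (0 : ℝ) 1, u x 0 = u₀ x

/-! ### Bilinear forms -/

/-- The weighted inner product `(w,v) = ∫₀¹ x^{N-1} w v dx`. -/
def wInner (N : ℕ) (w v : ℝ → ℝ) : ℝ := ∫ x in (0 : ℝ)..1, x ^ (N - 1) * (w x * v x)

/-- The form `A(w,v) = ∫₀¹ x^{N-1} w_x v_x dx`. It is applied to piecewise affine functions only,
for which `deriv` is the weak derivative away from the finitely many nodes. -/
def aForm (N : ℕ) (w v : ℝ → ℝ) : ℝ :=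
  ∫ x in (0 : ℝ)..1, x ^ (N - 1) * (deriv w x * deriv v x)

/-! ### Meshes and the finite element space -/

/-- Node points `0 = x₀ < x₁ < ⋯ < x_m = 1` with `m ≥ 1` (the values `x j` for `j > m`
play no role). -/
structure Mesh where
  m : ℕ
  m_pos : 0 < m
  x : ℕ → ℝ
  x_zero : x 0 = 0
  x_last : x m = 1
  x_lt : ∀ j < m, x j < x (j + 1)

namespace Mesh

/-- The granularity `h = max_j (x_{j+1} - x_j)`. -/
def h (M : Mesh) : ℝ := ⨆ j : Fin M.m, (M.x (j + 1) - M.x j)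

/-- Quasi-uniformity: `h ≤ β min_j (x_{j+1} - x_j)`. -/
def QuasiUniform (M : Mesh) (β : ℝ) : Prop := ∀ j < M.m, M.h ≤ β * (M.x (j + 1) - M.x j)

/-- The P1 finite element space: continuous functions on `[0,1]` that are affine on every
element and vanish at `1`. (Values outside `[0,1]` play no role.) -/
def space (M : Mesh) : Set (ℝ → ℝ) :=
  {v | ContinuousOn v (Set.Icc 0 1) ∧
    (∀ j < M.m, ∃ a b : ℝ, ∀ y ∈ Set.Ioo (M.x j) (M.x (j + 1)), v y = a + b * y) ∧
    v 1 = 0}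

/-- The nodal basis function `φ_i`, `0 ≤ i < m`. -/
def hat (M : Mesh) (i : ℕ) (y : ℝ) : ℝ :=
  if M.x i ≤ y then max 0 ((M.x (i + 1) - y) / (M.x (i + 1) - M.x i))
  else max 0 ((y - M.x (i - 1)) / (M.x i - M.x (i - 1)))

/-- The mass-lumped product `⟨w,v⟩ = ∑_{i=0}^{m-1} w(x_i) v(x_i) (1,φ_i)`. -/
def lumped (M : Mesh) (N : ℕ) (w v : ℝ → ℝ) : ℝ :=
  ∑ i ∈ Finset.range M.m, w (M.x i) * v (M.x i) * wInner N (fun _ => 1) (M.hat i)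

end Mesh

/-! ### Time grids and the scheme -/

/-- Positive time increments `τ_0, τ_1, …` with finite supremum. -/
structure TimeGrid where
  step : ℕ → ℝ
  step_pos : ∀ n, 0 < step n
  bdd : BddAbove (Set.range step)

namespace TimeGrid

/-- `t_n = ∑_{j<n} τ_j`. -/
def time (G : TimeGrid) (n : ℕ) : ℝ := ∑ j ∈ Finset.range n, G.step j

/-- `τ = sup_j τ_j`. -/
def tau (G : TimeGrid) : ℝ := ⨆ j, G.step j

end TimeGrid

/-- The time-step restriction `τ ≤ min_{0 ≤ i ≤ m-1} (1,φ_i) / A(φ_i,φ_i)`. -/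
def StepRestriction (N : ℕ) (M : Mesh) (G : TimeGrid) : Prop :=
  ∀ i < M.m, G.tau ≤ wInner N (fun _ => 1) (M.hat i) / aForm N (M.hat i) (M.hat i)

/-- `uh 0, uh 1, …` in the finite element space is a solution of the explicit mass-lumped scheme
`⟨(u_h^{n+1} - u_h^n)/τ_n, χ⟩ + A(u_h^n, χ) = ⟨f(u_h^n), χ⟩` for all `χ` in the space. -/
structure IsML2Solution (N : ℕ) (f : ℝ → ℝ) (M : Mesh) (G : TimeGrid)
    (uh : ℕ → ℝ → ℝ) : Prop where
  mem : ∀ n, uh n ∈ M.space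
  scheme : ∀ n, ∀ χ ∈ M.space,
    M.lumped N (fun y => (uh (n + 1) y - uh n y) / G.step n) χ + aForm N (uh n) χ =
      M.lumped N (fun y => f (uh n y)) χ

end RadialFEM

end

/-! The numerical solution is compared with the Ritz projection of `u`, which is explicit for a
radial problem: its slope on each element is the `x^{N-1}`-weighted mean of `u_x`, and it is summed
up from its zero value at `x = 1`. The mean value theorem shows that it is `O(h)`-close to `u` at
the nodes (`abs_ritz_sub_le`). Applied to the difference of `u` at two times, the same bound gains
the factor `|t - s|`.

Consistency comes from the conservative form `(x^{N-1} u_x)_x = x^{N-1} g`, `g = u_t - f(u)`.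
Testing it with a hat function turns the discrete fluxes of the projection into `∫ x^{N-1} g φ_i`,
and replacing `g` by its nodal value costs only its oscillation over the patch, relative to the
lumped mass (`abs_flux_sub_le`).

Stability is a maximum principle: the step restriction makes one explicit step a convex combination
of neighbouring nodal errors plus a residual (`abs_le_of_convex_step`). Hence `error_step` bounds
the new error by `(1 + Lτ_n)` times the old one plus `O(τ_n (h + τ))`, and `nodal_error` sums this
by a discrete Gronwall argument. Since `f` is only locally Lipschitz, the same induction keeps `u_h`
in `[-(K+1), K+1]`, where one constant `L` is available; this is why `h` and `τ` must be small. -/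

noncomputable section

namespace RadialFEM

open Set

/-! ### The mesh and its hat functions -/

namespace Mesh

variable (M : Mesh)

lemma x_mono {i j : ℕ} (hij : i ≤ j) (hj : j ≤ M.m) : M.x i ≤ M.x j := by
  induction j, hij using Nat.le_induction with
  | base => exact le_rfl
  | succ k _ ih => exact (ih (by omega)).trans (M.x_lt k (by omega)).le

lemma x_strict {i j : ℕ} (hij : i < j) (hj : j ≤ M.m) : M.x i < M.x j :=
  (M.x_lt i (by omega)).trans_le (M.x_mono hij hj)

lemma x_mem {i : ℕ} (hi : i ≤ M.m) : M.x i ∈ Icc (0 : ℝ) 1 := by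
  constructor
  · rw [← M.x_zero]; exact M.x_mono (Nat.zero_le _) hi
  · rw [← M.x_last]; exact M.x_mono hi le_rfl

lemma x_pred_le {i : ℕ} (hi : i < M.m) : M.x (i - 1) ≤ M.x i := M.x_mono (by omega) hi.le

lemma Icc_subset {i j : ℕ} (hij : i ≤ j) (hj : j ≤ M.m) :
    Icc (M.x i) (M.x j) ⊆ Icc (0 : ℝ) 1 :=
  Icc_subset_Icc (M.x_mem (hij.trans hj)).1 (M.x_mem hj).2

lemma diff_le_h {j : ℕ} (hj : j < M.m) : M.x (j + 1) - M.x j ≤ M.h :=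
  le_ciSup (f := fun j : Fin M.m => M.x (j + 1) - M.x j) (Set.finite_range _).bddAbove ⟨j, hj⟩

lemma h_pos : 0 < M.h :=
  (sub_pos.2 (M.x_lt 0 M.m_pos)).trans_le (M.diff_le_h M.m_pos)

lemma diff_pred_le_h {i : ℕ} (hi : i < M.m) : M.x i - M.x (i - 1) ≤ M.h := by
  rcases i with _ | i
  · simpa using M.h_pos.le
  · exact M.diff_le_h (by omega)

/-- Every point of `[0,1]` lies in some element. -/
lemma exists_element {y : ℝ} (hy : y ∈ Icc (0 : ℝ) 1) :
    ∃ j < M.m, y ∈ Icc (M.x j) (M.x (j + 1)) := by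
  by_contra! hcon
  have key : ∀ j ≤ M.m, M.x j ≤ y ∧ (0 < j → M.x j < y) := by
    intro j
    induction j with
    | zero => intro _; exact ⟨by rw [M.x_zero]; exact hy.1, by simp⟩
    | succ j ih =>
      intro hj
      have h1 : M.x (j + 1) < y := by
        by_contra! hle
        exact hcon j hj ⟨(ih (by omega)).1, hle⟩
      exact ⟨h1.le, fun _ => h1⟩
  have := (key M.m le_rfl).2 M.m_pos
  rw [M.x_last] at this
  exact absurd hy.2 (not_le.2 this)

variable {M} {i : ℕ}

lemma hat_right (hi : i < M.m) {y : ℝ} (hy : y ∈ Icc (M.x i) (M.x (i + 1))) :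
    M.hat i y = (M.x (i + 1) - y) / (M.x (i + 1) - M.x i) := by
  rw [hat, if_pos hy.1, max_eq_right]
  exact div_nonneg (sub_nonneg.2 hy.2) (sub_nonneg.2 (M.x_lt i hi).le)

lemma hat_left {y : ℝ} (hy : y ∈ Ico (M.x (i - 1)) (M.x i)) :
    M.hat i y = (y - M.x (i - 1)) / (M.x i - M.x (i - 1)) := by
  rw [hat, if_neg (not_le.2 hy.2), max_eq_right]
  exact div_nonneg (sub_nonneg.2 hy.1) (sub_nonneg.2 (hy.1.trans hy.2.le))

lemma hat_eq_zero_of_ge (hi : i < M.m) {y : ℝ} (hy : M.x (i + 1) ≤ y) : M.hat i y = 0 := by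
  have h1 := M.x_lt i hi
  rw [hat, if_pos (h1.le.trans hy), max_eq_left]
  exact div_nonpos_of_nonpos_of_nonneg (sub_nonpos.2 hy) (sub_nonneg.2 h1.le)

lemma hat_eq_zero_of_le {y : ℝ} (hy : y ≤ M.x (i - 1)) (hy' : y < M.x i)
    (hi : i < M.m) : M.hat i y = 0 := by
  rw [hat, if_neg (not_le.2 hy'), max_eq_left]
  exact div_nonpos_of_nonpos_of_nonneg (sub_nonpos.2 hy) (sub_nonneg.2 (M.x_pred_le hi))

lemma hat_self (hi : i < M.m) : M.hat i (M.x i) = 1 := by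
  rw [hat_right hi ⟨le_rfl, (M.x_lt i hi).le⟩, div_self (sub_pos.2 (M.x_lt i hi)).ne']

lemma hat_of_ne (hi : i < M.m) {j : ℕ} (hj : j ≤ M.m) (hij : j ≠ i) : M.hat i (M.x j) = 0 := by
  rcases lt_or_gt_of_ne hij with h | h
  · exact hat_eq_zero_of_le (M.x_mono (by omega) (by omega)) (M.x_strict h hi.le) hi
  · exact hat_eq_zero_of_ge hi (M.x_mono h hj)

lemma hat_pred (hi : i < M.m) (h0 : i ≠ 0) : M.hat i (M.x (i - 1)) = 0 :=
  hat_of_ne hi (by omega) (by omega)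

lemma continuousOn_hat (hi : i < M.m) : ContinuousOn (M.hat i) (Icc 0 1) := by
  have hR : Continuous fun y => max 0 ((M.x (i + 1) - y) / (M.x (i + 1) - M.x i)) := by fun_prop
  -- For `i = 0` the left branch is `0` by division by zero, so the hat jumps at `0`; only the right
  -- branch is seen on `[0,1]`.
  rcases Nat.eq_zero_or_pos i with rfl | h0
  · refine hR.continuousOn.congr fun y hy => ?_
    rw [hat, if_pos (by rw [M.x_zero]; exact hy.1)]
  · have hL : Continuous fun y => max 0 ((y - M.x (i - 1)) / (M.x i - M.x (i - 1))) := by fun_prop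
    refine Continuous.continuousOn (hR.if_le hL continuous_const continuous_id ?_)
    intro y hy
    subst hy
    rw [div_self (sub_pos.2 (M.x_lt i hi)).ne',
      div_self (sub_pos.2 (M.x_strict (by omega : i - 1 < i) hi.le)).ne']

lemma hat_mem_space (hi : i < M.m) : M.hat i ∈ M.space := by
  refine ⟨continuousOn_hat hi, fun j hj => ?_, ?_⟩
  · rcases lt_trichotomy j i with h | h | h
    · by_cases hji : j + 1 = i
      · subst hji
        refine ⟨-M.x j / (M.x (j + 1) - M.x j), 1 / (M.x (j + 1) - M.x j), fun y hy => ?_⟩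
        rw [hat_left (i := j + 1) ⟨hy.1.le, hy.2⟩, Nat.add_sub_cancel]
        ring
      · refine ⟨0, 0, fun y hy => ?_⟩
        have h1 : M.x (j + 1) ≤ M.x (i - 1) := M.x_mono (by omega) (by omega)
        rw [hat_eq_zero_of_le (hy.2.le.trans h1) (hy.2.trans (M.x_strict (by omega) hi.le)) hi]
        ring
    · subst h
      refine ⟨M.x (j + 1) / (M.x (j + 1) - M.x j), -1 / (M.x (j + 1) - M.x j), fun y hy => ?_⟩
      rw [hat_right hi ⟨hy.1.le, hy.2.le⟩]
      ring
    · refine ⟨0, 0, fun y hy => ?_⟩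
      rw [hat_eq_zero_of_ge hi ((M.x_mono h hj.le).trans hy.1.le)]
      ring
  · rw [← M.x_last]
    exact hat_of_ne hi le_rfl hi.ne'

/-- On each closed element a function of the space is the affine interpolant of its nodal
values. -/
lemma space_apply {w : ℝ → ℝ} (hw : w ∈ M.space) {j : ℕ} (hj : j < M.m) {y : ℝ}
    (hy : y ∈ Icc (M.x j) (M.x (j + 1))) :
    w y = w (M.x j) +
      (w (M.x (j + 1)) - w (M.x j)) / (M.x (j + 1) - M.x j) * (y - M.x j) := by
  obtain ⟨a, b, hab⟩ := hw.2.1 j hj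
  have hlt := M.x_lt j hj
  have key : EqOn w (fun y => a + b * y) (Icc (M.x j) (M.x (j + 1))) := by
    refine EqOn.of_subset_closure (s := Ioo (M.x j) (M.x (j + 1))) hab
      (hw.1.mono (M.Icc_subset (Nat.le_succ j) hj)) (by fun_prop) Ioo_subset_Icc_self ?_
    rw [closure_Ioo hlt.ne]
  have hd : M.x (j + 1) - M.x j ≠ 0 := (sub_pos.2 hlt).ne'
  rw [key hy, key ⟨le_rfl, hlt.le⟩, key ⟨hlt.le, le_rfl⟩]
  field_simp
  ring

lemma deriv_space {w : ℝ → ℝ} (hw : w ∈ M.space) {j : ℕ} (hj : j < M.m) {y : ℝ}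
    (hy : y ∈ Ioo (M.x j) (M.x (j + 1))) :
    deriv w y = (w (M.x (j + 1)) - w (M.x j)) / (M.x (j + 1) - M.x j) := by
  have h1 : w =ᶠ[nhds y] fun y => w (M.x j) +
      (w (M.x (j + 1)) - w (M.x j)) / (M.x (j + 1) - M.x j) * (y - M.x j) := by
    filter_upwards [Ioo_mem_nhds hy.1 hy.2] with z hz
    exact space_apply hw hj ⟨hz.1.le, hz.2.le⟩
  rw [h1.deriv_eq]
  have h2 := (((hasDerivAt_id y).sub_const (M.x j)).const_mul
    ((w (M.x (j + 1)) - w (M.x j)) / (M.x (j + 1) - M.x j))).const_add (w (M.x j))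
  simpa only [mul_one, id] using h2.deriv

end Mesh

/-! ### Integrals against hat functions -/

/-- An integral over `[0,1]` of a function supported in the patch of the `i`-th node splits into
the two element contributions. -/
lemma integral_patch {M : Mesh} {i : ℕ} (hi : i < M.m) {G gl gr : ℝ → ℝ}
    (h0 : ∀ y ∈ Ioo 0 (M.x (i - 1)), G y = 0)
    (hl : ∀ y ∈ Ioo (M.x (i - 1)) (M.x i), G y = gl y)
    (hr : ∀ y ∈ Ioo (M.x i) (M.x (i + 1)), G y = gr y)
    (h1 : ∀ y ∈ Ioo (M.x (i + 1)) 1, G y = 0)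
    (cl : Continuous gl) (cr : Continuous gr) :
    ∫ y in (0 : ℝ)..1, G y =
      (∫ y in M.x (i - 1)..M.x i, gl y) + ∫ y in M.x i..M.x (i + 1), gr y := by
  have l0 : 0 ≤ M.x (i - 1) := (M.x_mem (by omega)).1
  have l1 : M.x (i - 1) ≤ M.x i := M.x_pred_le hi
  have l2 : M.x i ≤ M.x (i + 1) := (M.x_lt i hi).le
  have l3 : M.x (i + 1) ≤ 1 := (M.x_mem hi).2
  have int : ∀ {a b : ℝ} {g : ℝ → ℝ}, a ≤ b → (∀ y ∈ Ioo a b, G y = g y) → Continuous g →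
      IntervalIntegrable G MeasureTheory.volume a b := by
    intro a b g hab hg hc
    refine (hc.intervalIntegrable a b).congr_uIoo fun y hy => ?_
    rw [uIoo_of_le hab] at hy
    exact (hg y hy).symm
  have i0 := int (g := fun _ => 0) l0 h0 continuous_const
  have i1 := int l1 hl cl
  have i2 := int l2 hr cr
  have i3 := int (g := fun _ => 0) l3 h1 continuous_const
  rw [← intervalIntegral.integral_add_adjacent_intervals i0 ((i1.trans i2).trans i3),
    ← intervalIntegral.integral_add_adjacent_intervals (i1.trans i2) i3,
    ← intervalIntegral.integral_add_adjacent_intervals i1 i2,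
    intervalIntegral.integral_congr_Ioo_of_le l0 h0,
    intervalIntegral.integral_congr_Ioo_of_le l1 hl,
    intervalIntegral.integral_congr_Ioo_of_le l2 hr,
    intervalIntegral.integral_congr_Ioo_of_le l3 h1]
  simp

/-- The weighted length `∫ₐᵇ x^{N-1} dx` of an element. -/
def weight (N : ℕ) (a b : ℝ) : ℝ := ∫ y in a..b, y ^ (N - 1)

/-- The stiffness coefficient of an element. -/
def stiffness (N : ℕ) (a b : ℝ) : ℝ := weight N a b / (b - a) ^ 2

lemma weight_nonneg {N : ℕ} {a b : ℝ} (ha : 0 ≤ a) (hab : a ≤ b) : 0 ≤ weight N a b :=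
  intervalIntegral.integral_nonneg hab fun _ hy => pow_nonneg (ha.trans hy.1) _

lemma weight_pos {N : ℕ} {a b : ℝ} (ha : 0 ≤ a) (hab : a < b) : 0 < weight N a b :=
  intervalIntegral.intervalIntegral_pos_of_pos_on
    ((continuous_pow (N - 1)).intervalIntegrable a b)
    (fun _ hy => pow_pos (ha.trans_lt hy.1) _) hab

lemma stiffness_nonneg {N : ℕ} {a b : ℝ} (ha : 0 ≤ a) (hab : a ≤ b) : 0 ≤ stiffness N a b :=
  div_nonneg (weight_nonneg ha hab) (sq_nonneg _)

/-- The lumped mass of the `i`-th node. -/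
def mass (N : ℕ) (M : Mesh) (i : ℕ) : ℝ := wInner N (fun _ => 1) (M.hat i)

lemma mass_eq {N : ℕ} {M : Mesh} {i : ℕ} (hi : i < M.m) :
    mass N M i =
      (∫ y in M.x (i - 1)..M.x i, y ^ (N - 1) * ((y - M.x (i - 1)) / (M.x i - M.x (i - 1)))) +
      ∫ y in M.x i..M.x (i + 1), y ^ (N - 1) * ((M.x (i + 1) - y) / (M.x (i + 1) - M.x i)) := by
  refine integral_patch hi (fun y hy => ?_) (fun y hy => ?_) (fun y hy => ?_) (fun y hy => ?_)
    (by fun_prop) (by fun_prop)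
  · rw [Mesh.hat_eq_zero_of_le hy.2.le (hy.2.trans_le (M.x_pred_le hi)) hi]; ring
  · rw [Mesh.hat_left ⟨hy.1.le, hy.2⟩]; ring
  · rw [Mesh.hat_right hi ⟨hy.1.le, hy.2.le⟩]; ring
  · rw [Mesh.hat_eq_zero_of_ge hi hy.1.le]; ring

lemma mass_pos {N : ℕ} {M : Mesh} {i : ℕ} (hi : i < M.m) : 0 < mass N M i := by
  have hx := (M.x_mem hi.le).1
  have hlt := M.x_lt i hi
  rw [mass_eq hi]
  refine add_pos_of_nonneg_of_pos
    (intervalIntegral.integral_nonneg (M.x_pred_le hi) fun y hy => ?_)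
    (intervalIntegral.intervalIntegral_pos_of_pos_on
      (Continuous.intervalIntegrable (by fun_prop) _ _) (fun y hy => ?_) hlt)
  · exact mul_nonneg (pow_nonneg ((M.x_mem (by omega)).1.trans hy.1) _)
      (div_nonneg (sub_nonneg.2 hy.1) (sub_nonneg.2 (M.x_pred_le hi)))
  · exact mul_pos (pow_pos (hx.trans_lt hy.1) _)
      (div_pos (sub_pos.2 hy.2) (sub_pos.2 hlt))

lemma lumped_hat {N : ℕ} {M : Mesh} {i : ℕ} (hi : i < M.m) (w : ℝ → ℝ) :
    M.lumped N w (M.hat i) = w (M.x i) * mass N M i := by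
  rw [Mesh.lumped, Finset.sum_eq_single i]
  · rw [Mesh.hat_self hi, mass, mul_one]
  · intro j hj hji
    rw [Mesh.hat_of_ne hi (Finset.mem_range.1 hj).le hji]
    ring
  · intro h
    exact absurd (Finset.mem_range.2 hi) h

/-- Both slopes are constant on each of the two elements of the patch, so each element contributes
its weighted length times their product. The neighbouring values get nonpositive coefficients, as
the maximum principle requires. -/
lemma aForm_hat {N : ℕ} {M : Mesh} {i : ℕ} (hi : i < M.m) {w : ℝ → ℝ} (hw : w ∈ M.space) :
    aForm N w (M.hat i) =
      stiffness N (M.x (i - 1)) (M.x i) * (w (M.x i) - w (M.x (i - 1))) -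
      stiffness N (M.x i) (M.x (i + 1)) * (w (M.x (i + 1)) - w (M.x i)) := by
  have hφ := Mesh.hat_mem_space (M := M) hi
  have main := integral_patch (M := M) hi
    (G := fun y => y ^ (N - 1) * (deriv w y * deriv (M.hat i) y))
    (gl := fun y => y ^ (N - 1) * ((w (M.x i) - w (M.x (i - 1))) / (M.x i - M.x (i - 1)) *
      (1 / (M.x i - M.x (i - 1)))))
    (gr := fun y => y ^ (N - 1) * ((w (M.x (i + 1)) - w (M.x i)) / (M.x (i + 1) - M.x i) *
      (-1 / (M.x (i + 1) - M.x i)))) ?_ ?_ ?_ ?_ (by fun_prop) (by fun_prop)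
  · rw [aForm, main, intervalIntegral.integral_mul_const, intervalIntegral.integral_mul_const,
      stiffness, stiffness, weight, weight]
    simp only [div_eq_mul_inv, ← inv_pow]
    ring
  · intro y hy
    have : M.hat i =ᶠ[nhds y] fun _ => 0 := by
      filter_upwards [Iio_mem_nhds hy.2] with z hz
      exact Mesh.hat_eq_zero_of_le (le_of_lt hz) (lt_of_lt_of_le hz (M.x_pred_le hi)) hi
    simp [this.deriv_eq]
  · intro y hy
    rcases Nat.eq_zero_or_pos i with rfl | h0
    · exact absurd (hy.1.trans hy.2) (lt_irrefl _)
    · obtain ⟨k, rfl⟩ : ∃ k, i = k + 1 := ⟨i - 1, by omega⟩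
      have hk : k < M.m := by omega
      simp only [Nat.add_sub_cancel] at hy ⊢
      have h2 := Mesh.hat_pred hi (by omega)
      rw [Nat.add_sub_cancel] at h2
      rw [Mesh.deriv_space hw hk hy, Mesh.deriv_space hφ hk hy, Mesh.hat_self hi, h2, sub_zero]
  · intro y hy
    rw [Mesh.deriv_space hw hi hy, Mesh.deriv_space hφ hi hy, Mesh.hat_self hi,
      Mesh.hat_of_ne hi hi (by omega), zero_sub]
  · intro y hy
    have : M.hat i =ᶠ[nhds y] fun _ => 0 := by
      filter_upwards [Ioi_mem_nhds hy.1] with z hz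
      exact Mesh.hat_eq_zero_of_ge hi (le_of_lt hz)
    simp [this.deriv_eq]

/-- Since `0 - 1 = 0` in `ℕ`, the left element of node `0` degenerates to a point. Its stiffness is
then `0 / 0 = 0`, which lets the nodal formulas hold at the centre without a separate case. -/
lemma stiffness_self (N : ℕ) (a : ℝ) : stiffness N a a = 0 := by simp [stiffness]

lemma aForm_hat_self {N : ℕ} {M : Mesh} {i : ℕ} (hi : i < M.m) :
    aForm N (M.hat i) (M.hat i) =
      stiffness N (M.x (i - 1)) (M.x i) + stiffness N (M.x i) (M.x (i + 1)) := by
  rw [aForm_hat hi (Mesh.hat_mem_space hi), Mesh.hat_self hi, Mesh.hat_of_ne hi hi (by omega)]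
  rcases Nat.eq_zero_or_pos i with rfl | h0
  · simp [stiffness_self]
  · rw [Mesh.hat_pred hi h0.ne']; ring

/-- The diagonal entry `A(φ_i, φ_i)` is the sum of the two adjacent stiffnesses, so the step
restriction makes the coefficient of the central value in an explicit step nonnegative. -/
lemma tau_mul_stiffness_le_mass {N : ℕ} {M : Mesh} {G : TimeGrid} (hG : StepRestriction N M G)
    {i : ℕ} (hi : i < M.m) :
    G.tau * (stiffness N (M.x (i - 1)) (M.x i) + stiffness N (M.x i) (M.x (i + 1))) ≤
      mass N M i := by
  have hx := (M.x_mem hi.le).1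
  have hlt := M.x_lt i hi
  have h1 : 0 < stiffness N (M.x i) (M.x (i + 1)) :=
    div_pos (weight_pos hx hlt) (pow_pos (sub_pos.2 hlt) 2)
  have h2 : 0 ≤ stiffness N (M.x (i - 1)) (M.x i) :=
    stiffness_nonneg (M.x_mem (by omega)).1 (M.x_pred_le hi)
  have := hG i hi
  rw [aForm_hat_self hi, le_div_iff₀ (by linarith)] at this
  exact this

/-- The scheme, written out at the `i`-th node. -/
lemma scheme_nodal {N : ℕ} {f : ℝ → ℝ} {M : Mesh} {G : TimeGrid} {uh : ℕ → ℝ → ℝ}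
    (H : IsML2Solution N f M G uh) (n : ℕ) {i : ℕ} (hi : i < M.m) :
    mass N M i * (uh (n + 1) (M.x i) - uh n (M.x i)) =
      G.step n * (stiffness N (M.x i) (M.x (i + 1)) * (uh n (M.x (i + 1)) - uh n (M.x i)) -
        stiffness N (M.x (i - 1)) (M.x i) * (uh n (M.x i) - uh n (M.x (i - 1))) +
        mass N M i * f (uh n (M.x i))) := by
  have := H.scheme n _ (Mesh.hat_mem_space hi)
  rw [lumped_hat hi, lumped_hat hi, aForm_hat hi (H.mem n)] at this
  have hs := (G.step_pos n).ne'
  field_simp at this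
  linarith

/-! ### Quantitative regularity of the solution -/

lemma abs_le_of_supNorm_le {α : Type*} {s : Set α} {v : α → ℝ} {K : ℝ≥0}
    (h : supNorm s v ≤ K) {y : α} (hy : y ∈ s) : |v y| ≤ K := by
  have h1 : ‖v y‖ₑ ≤ (K : ℝ≥0∞) := (le_iSup₂ (f := fun y (_ : y ∈ s) => ‖v y‖ₑ) y hy).trans h
  rw [enorm_eq_nnnorm, ENNReal.coe_le_coe] at h1
  exact_mod_cast h1

lemma supNorm_le_of_abs_le {α : Type*} {s : Set α} {v : α → ℝ} {c : ℝ}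
    (h : ∀ y ∈ s, |v y| ≤ c) : supNorm s v ≤ ENNReal.ofReal c := by
  refine iSup₂_le fun y hy => ?_
  rw [← ofReal_norm]
  exact ENNReal.ofReal_le_ofReal (h y hy)

/-- A function on an interval with derivative bounded by `C` is `C`-Lipschitz. -/
lemma abs_sub_le_of_hasDerivWithinAt {a b C : ℝ} {g g' : ℝ → ℝ}
    (hg : ∀ x ∈ Icc a b, HasDerivWithinAt g (g' x) (Icc a b) x)
    (hC : ∀ x ∈ Icc a b, |g' x| ≤ C) {x y : ℝ} (hx : x ∈ Icc a b) (hy : y ∈ Icc a b) :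
    |g x - g y| ≤ C * |x - y| :=
  (convex_Icc a b).norm_image_sub_le_of_norm_hasDerivWithin_le hg hC hy hx

/-- A derivative of a function that is Lipschitz at a point is bounded by the Lipschitz
constant. -/
lemma abs_deriv_le_of_lipschitz {a b C : ℝ} (hab : a < b) {g : ℝ → ℝ} {g' t : ℝ}
    (ht : t ∈ Icc a b) (hg : HasDerivWithinAt g g' (Icc a b) t)
    (hC : ∀ s ∈ Icc a b, |g s - g t| ≤ C * |s - t|) : |g'| ≤ C := by
  have hne : (nhdsWithin t (Icc a b \ {t})).NeBot :=
    accPt_principal_iff_nhdsWithin.1 ((uniqueDiffOn_Icc hab) t ht).accPt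
  refine le_of_tendsto (hasDerivWithinAt_iff_tendsto_slope.1 hg).abs ?_
  filter_upwards [self_mem_nhdsWithin] with s hs
  have hst : s - t ≠ 0 := sub_ne_zero.2 hs.2
  rw [slope_def_field, abs_div, div_le_iff₀ (abs_pos.2 hst)]
  exact hC s hs.1

/-- The properties of the exact solution and its derivatives that enter the error analysis. -/
structure RegularSolution (N : ℕ) (f : ℝ → ℝ) (T K : ℝ) (u ux ut : ℝ → ℝ → ℝ) : Prop where
  hasDeriv : ∀ t ∈ Icc 0 T, ∀ x ∈ Icc (0 : ℝ) 1,
    HasDerivWithinAt (fun y => u y t) (ux x t) (Icc 0 1) x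
  bound : ∀ t ∈ Icc 0 T, ∀ x ∈ Icc (0 : ℝ) 1, |u x t| ≤ K
  lipschitz : ∀ t ∈ Icc 0 T, ∀ x ∈ Icc (0 : ℝ) 1, ∀ y ∈ Icc (0 : ℝ) 1,
    |u x t - u y t| ≤ K * |x - y|
  lipschitz_x : ∀ t ∈ Icc 0 T, ∀ x ∈ Icc (0 : ℝ) 1, ∀ y ∈ Icc (0 : ℝ) 1,
    |ux x t - ux y t| ≤ K * |x - y|
  lipschitz_diff_x : ∀ t ∈ Icc 0 T, ∀ s ∈ Icc 0 T, ∀ x ∈ Icc (0 : ℝ) 1, ∀ y ∈ Icc (0 : ℝ) 1,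
    |(ux x t - ux x s) - (ux y t - ux y s)| ≤ K * |t - s| * |x - y|
  taylor_t : ∀ s ∈ Icc 0 T, ∀ t ∈ Icc s T, ∀ x ∈ Icc (0 : ℝ) 1,
    |u x t - u x s - (t - s) * ut x s| ≤ K * (t - s) ^ 2
  lipschitz_t : ∀ t ∈ Icc 0 T, ∀ x ∈ Icc (0 : ℝ) 1, ∀ y ∈ Icc (0 : ℝ) 1,
    |ut x t - ut y t| ≤ K * |x - y|
  equation : ∀ t ∈ Icc 0 T, ∀ x ∈ Ioo (0 : ℝ) 1, ∃ uxx,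
    HasDerivAt (fun y => ux y t) uxx x ∧
      ut x t = uxx + ((N : ℝ) - 1) / x * ux x t + f (u x t)
  boundary_one : ∀ t ∈ Icc 0 T, u 1 t = 0

lemma eq_of_eqOn_Ioc {T : ℝ} (hT : 0 < T) {p q : ℝ → ℝ} (hp : ContinuousOn p (Icc 0 T))
    (hq : ContinuousOn q (Icc 0 T)) (h : EqOn p q (Ioc 0 T)) : EqOn p q (Icc 0 T) :=
  h.of_subset_closure hp hq Ioc_subset_Icc_self (by rw [closure_Ioc hT.ne])

theorem regularSolution_of_isSolution {N : ℕ} {f : ℝ → ℝ} (hf : Continuous f) {T : ℝ}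
    (hT : 0 < T) {K : ℝ≥0} {u₀ : ℝ → ℝ} {u : ℝ → ℝ → ℝ} (hs : IsSmooth T u)
    (hu : IsSolution N f T u₀ u) (hK : kappa T u ≤ K) :
    RegularSolution N f T K u (partialX 1 u) (partialT T 1 u) := by
  have hbx : ∀ k ∈ Finset.Icc 0 2, ∀ x ∈ Icc (0 : ℝ) 1, ∀ t ∈ Icc 0 T, |partialX k u x t| ≤ K :=
    fun k hk x hx t ht => abs_le_of_supNorm_le (v := fun p : ℝ × ℝ => partialX k u p.1 p.2)
      ((Finset.single_le_sum
        (f := fun k => supNorm (cylinder T) (fun p : ℝ × ℝ => partialX k u p.1 p.2))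
        (fun _ _ => zero_le) hk).trans
        ((le_self_add.trans le_self_add).trans hK)) (y := (x, t)) ⟨hx, ht⟩
  have hbt : ∀ l ∈ Finset.Icc 1 2, ∀ x ∈ Icc (0 : ℝ) 1, ∀ t ∈ Icc 0 T,
      |partialT T l u x t| ≤ K :=
    fun l hl x hx t ht => abs_le_of_supNorm_le (v := fun p : ℝ × ℝ => partialT T l u p.1 p.2)
      ((Finset.single_le_sum
        (f := fun l => supNorm (cylinder T) (fun p : ℝ × ℝ => partialT T l u p.1 p.2))
        (fun _ _ => zero_le) hl).trans
        ((le_add_self.trans le_self_add).trans hK)) (y := (x, t)) ⟨hx, ht⟩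
  have hbtx : ∀ k ∈ Finset.Icc 1 2, ∀ x ∈ Icc (0 : ℝ) 1, ∀ t ∈ Icc 0 T,
      |partialTX T k u x t| ≤ K :=
    fun k hk x hx t ht => abs_le_of_supNorm_le (v := fun p : ℝ × ℝ => partialTX T k u p.1 p.2)
      ((Finset.single_le_sum
        (f := fun k => supNorm (cylinder T) (fun p : ℝ × ℝ => partialTX T k u p.1 p.2))
        (fun _ _ => zero_le) hk).trans
        (le_add_self.trans hK)) (y := (x, t)) ⟨hx, ht⟩
  have udx : UniqueDiffOn ℝ (Icc (0 : ℝ) 1) := uniqueDiffOn_Icc one_pos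
  have udt : UniqueDiffOn ℝ (Icc 0 T) := uniqueDiffOn_Icc hT
  have m0 : 0 ∈ Finset.Icc 0 2 := by decide
  have m1 : 1 ∈ Finset.Icc 0 2 := by decide
  have m2 : 2 ∈ Finset.Icc 0 2 := by decide
  have n1 : 1 ∈ Finset.Icc 1 2 := by decide
  have n2 : 2 ∈ Finset.Icc 1 2 := by decide
  have hdx : ∀ t ∈ Icc 0 T, ∀ x ∈ Icc (0 : ℝ) 1,
      HasDerivWithinAt (fun y => u y t) (partialX 1 u x t) (Icc 0 1) x := by
    intro t ht x hx
    rw [partialX, iteratedDerivWithin_one]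
    exact ((hs.contDiff_x t ht).differentiableOn two_ne_zero x hx).hasDerivWithinAt
  have hdxx : ∀ t ∈ Icc 0 T, ∀ x ∈ Icc (0 : ℝ) 1,
      HasDerivWithinAt (fun y => partialX 1 u y t) (partialX 2 u x t) (Icc 0 1) x := by
    intro t ht x hx
    rw [partialX, iteratedDerivWithin_succ (n := 1)]
    exact ((hs.contDiff_x t ht).differentiableOn_iteratedDerivWithin (m := 1)
      (by norm_num) udx x hx).hasDerivWithinAt
  have hdt : ∀ x ∈ Icc (0 : ℝ) 1, ∀ t ∈ Icc 0 T,
      HasDerivWithinAt (fun s => u x s) (partialT T 1 u x t) (Icc 0 T) t := by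
    intro x hx t ht
    rw [partialT, iteratedDerivWithin_one]
    exact ((hs.contDiff_t x hx).differentiableOn two_ne_zero t ht).hasDerivWithinAt
  have hdtt : ∀ x ∈ Icc (0 : ℝ) 1, ∀ t ∈ Icc 0 T,
      HasDerivWithinAt (fun s => partialT T 1 u x s) (partialT T 2 u x t) (Icc 0 T) t := by
    intro x hx t ht
    rw [partialT, iteratedDerivWithin_succ (n := 1)]
    exact ((hs.contDiff_t x hx).differentiableOn_iteratedDerivWithin (m := 1)
      (by norm_num) udt t ht).hasDerivWithinAt
  have hlt : ∀ k ∈ Finset.Icc 1 2, ∀ x ∈ Icc (0 : ℝ) 1, ∀ t ∈ Icc 0 T, ∀ s ∈ Icc 0 T,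
      |partialX k u x t - partialX k u x s| ≤ K * |t - s| := by
    intro k hk x hx t ht s hs'
    exact abs_sub_le_of_hasDerivWithinAt (g := fun s => partialX k u x s)
      (fun s hs' => (hs.diff_tx k hk x hx s hs').hasDerivWithinAt)
      (fun s hs' => hbtx k hk x hx s hs') ht hs'
  have slice : ∀ {F : ℝ → ℝ → ℝ}, ContinuousOn (fun p : ℝ × ℝ => F p.1 p.2) (cylinder T) →
      ∀ x ∈ Icc (0 : ℝ) 1, ContinuousOn (fun t => F x t) (Icc 0 T) := by
    intro F hF x hx
    exact hF.comp (f := fun t : ℝ => (x, t)) (by fun_prop) fun t ht => ⟨hx, ht⟩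
  have hcu : ∀ x ∈ Icc (0 : ℝ) 1, ContinuousOn (fun t => u x t) (Icc 0 T) :=
    fun x hx => (hs.contDiff_t x hx).continuousOn
  refine
    { hasDeriv := hdx
      bound := fun t ht x hx => by simpa [partialX] using hbx 0 m0 x hx t ht
      lipschitz := fun t ht x hx y hy =>
        abs_sub_le_of_hasDerivWithinAt (hdx t ht) (fun x hx => hbx 1 m1 x hx t ht) hx hy
      lipschitz_x := fun t ht x hx y hy =>
        abs_sub_le_of_hasDerivWithinAt (hdxx t ht) (fun x hx => hbx 2 m2 x hx t ht) hx hy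
      lipschitz_diff_x := fun t ht s hs' x hx y hy =>
        abs_sub_le_of_hasDerivWithinAt
          (fun x hx => (hdxx t ht x hx).sub (hdxx s hs' x hx))
          (fun x hx => hlt 2 n2 x hx t ht s hs') hx hy
      taylor_t := ?_
      lipschitz_t := ?_
      equation := ?_
      boundary_one := eq_of_eqOn_Ioc hT (hcu 1 ⟨zero_le_one, le_rfl⟩) continuousOn_const
        hu.boundary_one }
  · intro s hs' t ht x hx
    have hsub : Icc s t ⊆ Icc 0 T := Icc_subset_Icc hs'.1 ht.2
    -- After subtracting the tangent at `s`, the derivative in time is at most `K (t - s)` on `[s,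
    -- t]`, and the mean value inequality gives the quadratic remainder.
    have hd : ∀ r ∈ Icc s t, HasDerivWithinAt (fun r => u x r - r * partialT T 1 u x s)
        (partialT T 1 u x r - 1 * partialT T 1 u x s) (Icc s t) r := fun r hr =>
      ((hdt x hx r (hsub hr)).mono hsub).sub
        ((hasDerivWithinAt_id r _).mul_const (partialT T 1 u x s))
    have hb : ∀ r ∈ Icc s t,
        |partialT T 1 u x r - 1 * partialT T 1 u x s| ≤ K * (t - s) := by
      intro r hr
      rw [one_mul]
      refine (abs_sub_le_of_hasDerivWithinAt (hdtt x hx) (fun t ht => hbt 2 n2 x hx t ht)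
        (hsub hr) hs').trans ?_
      rw [abs_of_nonneg (sub_nonneg.2 hr.1)]
      exact mul_le_mul_of_nonneg_left (by linarith [hr.2]) K.2
    have := abs_sub_le_of_hasDerivWithinAt hd hb ⟨ht.1, le_rfl⟩ ⟨le_rfl, ht.1⟩
    rw [abs_of_nonneg (sub_nonneg.2 ht.1)] at this
    calc _ = _ := by congr 1; ring
      _ ≤ _ := this
      _ = _ := by ring
  · intro t ht x hx y hy
    -- `κ` controls `∂ₜ∂ₓu`, not `∂ₓ∂ₜu`. The bound on the former makes `s ↦ u x s - u y s`
    -- Lipschitz with constant `K |x - y|`, which then bounds its time derivative.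
    refine abs_deriv_le_of_lipschitz hT ht ((hdt x hx t ht).sub (hdt y hy t ht)) fun s hs' => ?_
    have := abs_sub_le_of_hasDerivWithinAt
      (fun x hx => (hdx s hs' x hx).sub (hdx t ht x hx))
      (fun x hx => hlt 1 n1 x hx s hs' t ht) hx hy
    calc _ = _ := by congr 1; simp only [Pi.sub_apply]; ring
      _ ≤ _ := this
      _ = _ := by ring
  · intro t ht x hx
    have hx' := Ioo_subset_Icc_self hx
    refine ⟨partialX 2 u x t, (hdxx t ht x hx').hasDerivAt (Icc_mem_nhds hx.1 hx.2), ?_⟩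
    -- The equation is given only for `t > 0`; continuity extends it to `t = 0`, where the first
    -- time step starts.
    exact eq_of_eqOn_Ioc hT (slice (hs.cont_t 1 n1) x hx')
      (((slice (hs.cont_x 2 m2) x hx').add
        (continuousOn_const.mul (slice (hs.cont_x 1 m1) x hx'))).add
        (hf.comp_continuousOn (hcu x hx')))
      (fun t ht => hu.equation x hx t ht) ht

/-- The initial condition extends to the closed interval by continuity. -/
lemma initial_Icc {N : ℕ} {f : ℝ → ℝ} {T : ℝ} (hT : 0 < T) {u₀ : ℝ → ℝ} {u : ℝ → ℝ → ℝ}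
    (h₀ : ContinuousOn u₀ (Icc 0 1)) (hs : IsSmooth T u) (hu : IsSolution N f T u₀ u) :
    EqOn (fun x => u x 0) u₀ (Icc 0 1) :=
  EqOn.of_subset_closure hu.initial (hs.contDiff_x 0 ⟨le_rfl, hT.le⟩).continuousOn h₀
    Ioo_subset_Icc_self (by rw [closure_Ioo zero_ne_one])

/-! ### The Ritz projection -/

/-- Freezing `g` costs its oscillation times the mass of the weight. This serves both the weighted
means in the Ritz projection and the lumping error. -/
lemma abs_integral_mul_sub_le {a b c δ : ℝ} (hab : a ≤ b) {p g : ℝ → ℝ} (hp : Continuous p)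
    (hp0 : ∀ y ∈ Icc a b, 0 ≤ p y) (hg : ContinuousOn g (Icc a b))
    (hδ : ∀ y ∈ Icc a b, |g y - c| ≤ δ) :
    |(∫ y in a..b, p y * g y) - c * ∫ y in a..b, p y| ≤ δ * ∫ y in a..b, p y := by
  have hi : IntervalIntegrable (fun y => p y * g y) MeasureTheory.volume a b :=
    ContinuousOn.intervalIntegrable (by rw [uIcc_of_le hab]; exact hp.continuousOn.mul hg)
  rw [← intervalIntegral.integral_const_mul, ← intervalIntegral.integral_const_mul,
    ← intervalIntegral.integral_sub hi ((hp.const_mul c).intervalIntegrable a b),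
    ← Real.norm_eq_abs]
  refine intervalIntegral.norm_integral_le_of_norm_le hab
    (Filter.Eventually.of_forall fun y hy => ?_) ((hp.const_mul δ).intervalIntegrable a b)
  have hy' := Ioc_subset_Icc_self hy
  rw [Real.norm_eq_abs, show p y * g y - c * p y = (g y - c) * p y by ring, abs_mul,
    abs_of_nonneg (hp0 y hy')]
  exact mul_le_mul_of_nonneg_right (hδ y hy') (hp0 y hy')

/-- The nodal values of the Ritz projection of a function `v` with derivative `v'` and
`v 1 = 0`. -/
def ritz (N : ℕ) (M : Mesh) (v' : ℝ → ℝ) (i : ℕ) : ℝ :=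
  -∑ j ∈ Finset.Ico i M.m, (M.x (j + 1) - M.x j) *
    ((∫ y in M.x j..M.x (j + 1), y ^ (N - 1) * v' y) / weight N (M.x j) (M.x (j + 1)))

lemma ritz_last (N : ℕ) (M : Mesh) (v' : ℝ → ℝ) : ritz N M v' M.m = 0 := by simp [ritz]

lemma ritz_succ_sub {N : ℕ} {M : Mesh} {v' : ℝ → ℝ} {i : ℕ} (hi : i < M.m) :
    ritz N M v' (i + 1) - ritz N M v' i = (M.x (i + 1) - M.x i) *
      ((∫ y in M.x i..M.x (i + 1), y ^ (N - 1) * v' y) / weight N (M.x i) (M.x (i + 1))) := by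
  rw [ritz, ritz, Finset.sum_eq_sum_Ico_succ_bot hi]
  ring

/-- The weight in the stiffness cancels the one in the mean: up to sign, the element's contribution
to the form against `φ_i` is the exact one, which is the Galerkin orthogonality of the projection.
-/
lemma stiffness_mul_ritz {N : ℕ} {M : Mesh} {v' : ℝ → ℝ} {i : ℕ} (hi : i < M.m) :
    stiffness N (M.x i) (M.x (i + 1)) * (ritz N M v' (i + 1) - ritz N M v' i) =
      (∫ y in M.x i..M.x (i + 1), y ^ (N - 1) * v' y) / (M.x (i + 1) - M.x i) := by
  have h1 : M.x (i + 1) - M.x i ≠ 0 := (sub_pos.2 (M.x_lt i hi)).ne'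
  have h2 := (weight_pos (N := N) (M.x_mem hi.le).1 (M.x_lt i hi)).ne'
  rw [ritz_succ_sub hi, stiffness]
  field_simp

lemma stiffness_mul_ritz_pred {N : ℕ} {M : Mesh} {v' : ℝ → ℝ} {i : ℕ} (hi : i < M.m) :
    stiffness N (M.x (i - 1)) (M.x i) * (ritz N M v' i - ritz N M v' (i - 1)) =
      (∫ y in M.x (i - 1)..M.x i, y ^ (N - 1) * v' y) / (M.x i - M.x (i - 1)) := by
  rcases i with _ | i
  · simp
  · exact stiffness_mul_ritz (by omega)

/-- Linearity allows the error bound to be applied to time increments. -/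
lemma ritz_sub {N : ℕ} {M : Mesh} {v' w' : ℝ → ℝ} (hv : ContinuousOn v' (Icc 0 1))
    (hw : ContinuousOn w' (Icc 0 1)) (i : ℕ) :
    ritz N M (fun y => v' y - w' y) i = ritz N M v' i - ritz N M w' i := by
  simp only [ritz]
  rw [neg_sub_neg, ← Finset.sum_sub_distrib, ← Finset.sum_neg_distrib]
  refine Finset.sum_congr rfl fun j hj => ?_
  have hj' := (Finset.mem_Ico.1 hj).2
  have hsub := M.Icc_subset (Nat.le_succ j) hj'
  have int : ∀ {q : ℝ → ℝ}, ContinuousOn q (Icc 0 1) → IntervalIntegrable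
      (fun y => y ^ (N - 1) * q y) MeasureTheory.volume (M.x j) (M.x (j + 1)) := fun hq =>
    ContinuousOn.intervalIntegrable (by
      rw [uIcc_of_le (M.x_lt j hj').le]
      exact (continuous_pow _).continuousOn.mul (hq.mono hsub))
  simp only [mul_sub]
  rw [intervalIntegral.integral_sub (int hv) (int hw)]
  ring

/-- The difference quotient is `v' ξ` for some `ξ` in the element, and `v'` varies by at most `B (b
- a)` there. Any nonnegative weight of positive mass gives the same bound, so nothing degenerates
near `0`. -/
lemma abs_weightedMean_sub_le {N : ℕ} {a b B : ℝ} (ha : 0 ≤ a) (hab : a < b) (hb : b ≤ 1)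
    {v v' : ℝ → ℝ} (hv : ∀ x ∈ Icc (0 : ℝ) 1, HasDerivWithinAt v (v' x) (Icc 0 1) x)
    (hB : 0 ≤ B) (hc : ContinuousOn v' (Icc 0 1))
    (hv' : ∀ x ∈ Icc (0 : ℝ) 1, ∀ y ∈ Icc (0 : ℝ) 1, |v' x - v' y| ≤ B * |x - y|) :
    |(b - a) * ((∫ y in a..b, y ^ (N - 1) * v' y) / weight N a b) - (v b - v a)| ≤
      B * (b - a) * (b - a) := by
  have hsub : Icc a b ⊆ Icc 0 1 := Icc_subset_Icc ha hb
  have hba := sub_pos.2 hab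
  obtain ⟨ξ, hξ, hslope⟩ := exists_hasDerivAt_eq_slope v v' hab
    (fun x hx => ((hv x (hsub hx)).mono hsub).continuousWithinAt)
    (fun x hx => (hv x (hsub (Ioo_subset_Icc_self hx))).hasDerivAt
      (Icc_mem_nhds (ha.trans_lt hx.1) (hx.2.trans_le hb)))
  have hξ' := Ioo_subset_Icc_self hξ
  have hw := weight_pos (N := N) ha hab
  have h1 := abs_integral_mul_sub_le (c := v' ξ) (δ := B * (b - a)) hab.le
    (continuous_pow (N - 1)) (fun y hy => pow_nonneg (ha.trans hy.1) _) (hc.mono hsub)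
    (fun y hy => (hv' y (hsub hy) ξ (hsub hξ')).trans (mul_le_mul_of_nonneg_left
      (abs_le.2 ⟨by linarith [hy.1, hξ.2], by linarith [hy.2, hξ.1]⟩) hB))
  change |_ - v' ξ * weight N a b| ≤ B * (b - a) * weight N a b at h1
  have h2 : v b - v a = (b - a) * v' ξ := by rw [hslope]; field_simp
  rw [h2, ← mul_sub, abs_mul, abs_of_pos hba, mul_comm (b - a)]
  refine mul_le_mul_of_nonneg_right ?_ hba.le
  rw [div_sub' hw.ne', abs_div, abs_of_pos hw, div_le_iff₀ hw, mul_comm (weight N a b) (v' ξ)]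
  exact h1

lemma continuousOn_of_abs_le {B : ℝ} {g : ℝ → ℝ} {s : Set ℝ} (hB : 0 ≤ B)
    (h : ∀ x ∈ s, ∀ y ∈ s, |g x - g y| ≤ B * |x - y|) : ContinuousOn g s :=
  (LipschitzOnWith.of_dist_le_mul (K := ⟨B, hB⟩) fun x hx y hy => h x hx y hy).continuousOn

/-- First order error bound for the Ritz projection in the maximum norm. -/
lemma abs_ritz_sub_le {N : ℕ} {M : Mesh} {B : ℝ} (hB : 0 ≤ B) {v v' : ℝ → ℝ}
    (hv : ∀ x ∈ Icc (0 : ℝ) 1, HasDerivWithinAt v (v' x) (Icc 0 1) x)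
    (hv' : ∀ x ∈ Icc (0 : ℝ) 1, ∀ y ∈ Icc (0 : ℝ) 1, |v' x - v' y| ≤ B * |x - y|)
    (hv1 : v 1 = 0) {i : ℕ} (hi : i ≤ M.m) : |ritz N M v' i - v (M.x i)| ≤ B * M.h := by
  have hBh : 0 ≤ B * M.h := mul_nonneg hB M.h_pos.le
  -- Downward induction from `x = 1`, where both values vanish; the local errors are at most `B h`
  -- times the element length and sum to `B h` times the distance to `1`.
  have key : |ritz N M v' i - v (M.x i)| ≤ B * M.h * (1 - M.x i) := by
    induction hi using Nat.decreasingInduction with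
    | self => simp [ritz_last, M.x_last, hv1]
    | of_succ j hj ih =>
      have h1 := abs_weightedMean_sub_le (N := N) (M.x_mem hj.le).1 (M.x_lt j hj) (M.x_mem hj).2
        hv hB (continuousOn_of_abs_le hB hv') hv'
      rw [← ritz_succ_sub hj] at h1
      have hd := sub_pos.2 (M.x_lt j hj)
      have h2 : B * (M.x (j + 1) - M.x j) * (M.x (j + 1) - M.x j) ≤
          B * M.h * (M.x (j + 1) - M.x j) :=
        mul_le_mul_of_nonneg_right (mul_le_mul_of_nonneg_left (M.diff_le_h hj) hB) hd.le
      have h3 := abs_sub (ritz N M v' (j + 1) - v (M.x (j + 1)))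
        (ritz N M v' (j + 1) - ritz N M v' j - (v (M.x (j + 1)) - v (M.x j)))
      calc |ritz N M v' j - v (M.x j)|
          = |ritz N M v' (j + 1) - v (M.x (j + 1)) -
            (ritz N M v' (j + 1) - ritz N M v' j - (v (M.x (j + 1)) - v (M.x j)))| := by
            congr 1; ring
        _ ≤ _ := h3
        _ ≤ B * M.h * (1 - M.x (j + 1)) + B * M.h * (M.x (j + 1) - M.x j) := by linarith
        _ = _ := by ring
  refine key.trans (mul_le_of_le_one_right hBh ?_)
  linarith [(M.x_mem hi).1]

/-! ### Consistency of the flux differences -/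

/-- The hypothesis `heq` says `(x^{N-1} v)' = x^{N-1} g`, here integrated by parts against `c + d
x`. The derivative is needed only in the open interval, so the singular coefficient at `0` does no
harm. -/
lemma integral_flux {N : ℕ} (hN : 2 ≤ N) {v g : ℝ → ℝ} (hv : ContinuousOn v (Icc 0 1))
    (hg : ContinuousOn g (Icc 0 1))
    (heq : ∀ x ∈ Ioo (0 : ℝ) 1, ∃ v₂, HasDerivAt v v₂ x ∧ g x = v₂ + ((N : ℝ) - 1) / x * v x)
    {a b : ℝ} (ha : 0 ≤ a) (hab : a ≤ b) (hb : b ≤ 1) (c d : ℝ) :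
    (∫ y in a..b, y ^ (N - 1) * (c + d * y) * g y) + d * ∫ y in a..b, y ^ (N - 1) * v y =
      b ^ (N - 1) * v b * (c + d * b) - a ^ (N - 1) * v a * (c + d * a) := by
  have hsub : Icc a b ⊆ Icc 0 1 := Icc_subset_Icc ha hb
  have hv' := hv.mono hsub
  have hg' := hg.mono hsub
  have i1 : IntervalIntegrable (fun y => y ^ (N - 1) * (c + d * y) * g y)
      MeasureTheory.volume a b :=
    ContinuousOn.intervalIntegrable (by rw [uIcc_of_le hab]; fun_prop)
  have i2 : IntervalIntegrable (fun y => d * (y ^ (N - 1) * v y)) MeasureTheory.volume a b :=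
    ContinuousOn.intervalIntegrable (by rw [uIcc_of_le hab]; fun_prop)
  rw [← intervalIntegral.integral_const_mul, ← intervalIntegral.integral_add i1 i2]
  refine intervalIntegral.integral_eq_sub_of_hasDerivAt_of_le hab
    (f := fun y => y ^ (N - 1) * v y * (c + d * y)) (by fun_prop) (fun x hx => ?_) (i1.add i2)
  have hx0 : 0 < x := ha.trans_lt hx.1
  obtain ⟨v₂, hv₂, hgx⟩ := heq x ⟨hx0, hx.2.trans_le hb⟩
  have h1 := ((hasDerivAt_pow (N - 1) x).mul hv₂).mul
    (((hasDerivAt_id x).const_mul d).const_add c)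
  refine h1.congr_deriv ?_
  obtain ⟨k, rfl⟩ := Nat.exists_eq_add_of_le' hN
  have e1 : k + 2 - 1 = k + 1 := by omega
  rw [hgx, e1]
  simp only [Nat.add_sub_cancel, Pi.mul_apply, id]
  push_cast
  field_simp
  ring

/-- The Ritz projection satisfies the lumped discrete equation up to first order. -/
lemma abs_flux_sub_le {N : ℕ} (hN : 2 ≤ N) {M : Mesh} {v g : ℝ → ℝ} {B : ℝ} (hB : 0 ≤ B)
    (hv : ContinuousOn v (Icc 0 1))
    (hg : ∀ x ∈ Icc (0 : ℝ) 1, ∀ y ∈ Icc (0 : ℝ) 1, |g x - g y| ≤ B * |x - y|)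
    (heq : ∀ x ∈ Ioo (0 : ℝ) 1, ∃ v₂, HasDerivAt v v₂ x ∧ g x = v₂ + ((N : ℝ) - 1) / x * v x)
    {i : ℕ} (hi : i < M.m) :
    |stiffness N (M.x i) (M.x (i + 1)) * (ritz N M v (i + 1) - ritz N M v i) -
      stiffness N (M.x (i - 1)) (M.x i) * (ritz N M v i - ritz N M v (i - 1)) -
      mass N M i * g (M.x i)| ≤ B * M.h * mass N M i := by
  have hgc := continuousOn_of_abs_le hB hg
  have a0 : 0 ≤ M.x (i - 1) := (M.x_mem (by omega)).1
  have a1 := M.x_pred_le hi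
  have a2 := M.x_lt i hi
  have a3 : M.x (i + 1) ≤ 1 := (M.x_mem hi).2
  have hx := M.x_mem hi.le
  have fr := integral_flux hN hv hgc heq hx.1 a2.le a3 (M.x (i + 1) / (M.x (i + 1) - M.x i))
    (-1 / (M.x (i + 1) - M.x i))
  have fl := integral_flux hN hv hgc heq a0 a1 hx.2 (-M.x (i - 1) / (M.x i - M.x (i - 1)))
    (1 / (M.x i - M.x (i - 1)))
  have er : ∀ y, M.x (i + 1) / (M.x (i + 1) - M.x i) + -1 / (M.x (i + 1) - M.x i) * y =
      (M.x (i + 1) - y) / (M.x (i + 1) - M.x i) := fun y => by ring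
  have el : ∀ y, -M.x (i - 1) / (M.x i - M.x (i - 1)) + 1 / (M.x i - M.x (i - 1)) * y =
      (y - M.x (i - 1)) / (M.x i - M.x (i - 1)) := fun y => by ring
  simp only [er] at fr
  simp only [el] at fl
  -- At node `0` the quotient is `0 / 0 = 0`, but the factor `x_0^{N-1}` vanishes too. The two
  -- boundary terms at `x_i` therefore always cancel when `fl` and `fr` are added.
  have hend : M.x i ^ (N - 1) * v (M.x i) * ((M.x i - M.x (i - 1)) / (M.x i - M.x (i - 1))) =
      M.x i ^ (N - 1) * v (M.x i) := by
    rcases Nat.eq_zero_or_pos i with rfl | h0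
    · rw [M.x_zero, zero_pow (by omega)]; ring
    · rw [div_self (sub_pos.2 (M.x_strict (by omega : i - 1 < i) hi.le)).ne', mul_one]
  rw [hend] at fl
  have h1 := (sub_pos.2 a2).ne'
  rw [div_self h1] at fr
  have br := abs_integral_mul_sub_le (g := g) (c := g (M.x i)) (δ := B * M.h) a2.le
    (p := fun y => y ^ (N - 1) * ((M.x (i + 1) - y) / (M.x (i + 1) - M.x i))) (by fun_prop)
    (fun y hy => mul_nonneg (pow_nonneg (hx.1.trans hy.1) _)
      (div_nonneg (sub_nonneg.2 hy.2) (sub_nonneg.2 a2.le)))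
    (hgc.mono (Icc_subset_Icc hx.1 a3))
    (fun y hy => (hg y ⟨hx.1.trans hy.1, hy.2.trans a3⟩ _ hx).trans
      (mul_le_mul_of_nonneg_left
        ((abs_le.2 ⟨by linarith [hy.1], by linarith [hy.2]⟩ : _ ≤ M.x (i + 1) - M.x i).trans
          (M.diff_le_h hi)) hB))
  have bl := abs_integral_mul_sub_le (g := g) (c := g (M.x i)) (δ := B * M.h) a1
    (p := fun y => y ^ (N - 1) * ((y - M.x (i - 1)) / (M.x i - M.x (i - 1)))) (by fun_prop)
    (fun y hy => mul_nonneg (pow_nonneg (a0.trans hy.1) _)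
      (div_nonneg (sub_nonneg.2 hy.1) (sub_nonneg.2 a1)))
    (hgc.mono (Icc_subset_Icc a0 hx.2))
    (fun y hy => (hg y ⟨a0.trans hy.1, hy.2.trans hx.2⟩ _ hx).trans
      (mul_le_mul_of_nonneg_left
        ((abs_le.2 ⟨by linarith [hy.1], by linarith [hy.2]⟩ : _ ≤ M.x i - M.x (i - 1)).trans
          (M.diff_pred_le_h hi)) hB))
  rw [stiffness_mul_ritz hi, stiffness_mul_ritz_pred hi, mass_eq hi]
  have hsum := (abs_add_le _ _).trans (add_le_add bl br)
  refine le_of_eq_of_le (congrArg _ ?_) (hsum.trans_eq (by ring))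
  simp only [sub_self, zero_div, mul_zero, zero_sub] at fr fl
  rw [neg_div, neg_mul, one_div_mul_eq_div] at fr
  rw [one_div_mul_eq_div] at fl
  linear_combination -fr - fl

/-! ### The error recursion -/

namespace TimeGrid

variable (G : TimeGrid)

lemma time_succ (n : ℕ) : G.time (n + 1) = G.time n + G.step n := Finset.sum_range_succ _ _

lemma time_nonneg (n : ℕ) : 0 ≤ G.time n := Finset.sum_nonneg fun j _ => (G.step_pos j).le

lemma step_le_tau (n : ℕ) : G.step n ≤ G.tau := le_ciSup G.bdd n

lemma tau_pos : 0 < G.tau := (G.step_pos 0).trans_le (G.step_le_tau 0)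

end TimeGrid

lemma last_eq_zero {M : Mesh} {w : ℝ → ℝ} (hw : w ∈ M.space) : w (M.x M.m) = 0 := by
  rw [M.x_last]; exact hw.2.2

/-- A convex combination of nodal values plus perturbations: the algebra of the maximum
principle for one explicit step. -/
lemma abs_le_of_convex_step {μ s α α' θ θr θl θ' a r : ℝ} (hμ : 0 < μ) (hs : 0 ≤ s)
    (hα : 0 ≤ α) (hα' : 0 ≤ α') (hsα : s * (α' + α) ≤ μ) (h : |θ| ≤ a) (hr : |θr| ≤ a)
    (hl : |θl| ≤ a)
    (hres : |μ * (θ' - θ) - s * (α * (θr - θ) - α' * (θ - θl))| ≤ μ * r) : |θ'| ≤ a + r := by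
  -- The three coefficients are nonnegative and add up to `μ`.
  have c1 : |(μ - s * (α' + α)) * θ + s * α * θr + s * α' * θl| ≤ μ * a := by
    refine (abs_add_three _ _ _).trans ?_
    rw [abs_mul _ θ, abs_mul _ θr, abs_mul _ θl, abs_of_nonneg (sub_nonneg.2 hsα),
      abs_of_nonneg (mul_nonneg hs hα), abs_of_nonneg (mul_nonneg hs hα')]
    calc _ ≤ (μ - s * (α' + α)) * a + s * α * a + s * α' * a :=
          add_le_add_three (mul_le_mul_of_nonneg_left h (sub_nonneg.2 hsα))
            (mul_le_mul_of_nonneg_left hr (mul_nonneg hs hα))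
            (mul_le_mul_of_nonneg_left hl (mul_nonneg hs hα'))
      _ = μ * a := by ring
  have c2 := (abs_add_le _ _).trans (add_le_add c1 hres)
  rw [show (μ - s * (α' + α)) * θ + s * α * θr + s * α' * θl +
    (μ * (θ' - θ) - s * (α * (θr - θ) - α' * (θ - θl))) = μ * θ' by ring,
    abs_mul, abs_of_pos hμ, ← mul_add] at c2
  exact le_of_mul_le_mul_left c2 hμ

section Step

variable {N : ℕ} {f : ℝ → ℝ} {T K L : ℝ} {u ux ut : ℝ → ℝ → ℝ} {M : Mesh} {G : TimeGrid}
  {uh : ℕ → ℝ → ℝ}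

lemma ritz_solution_sub_le (hK : 0 ≤ K) (R : RegularSolution N f T K u ux ut) {t : ℝ}
    (ht : t ∈ Icc 0 T) {i : ℕ} (hi : i ≤ M.m) :
    |ritz N M (fun y => ux y t) i - u (M.x i) t| ≤ K * M.h :=
  abs_ritz_sub_le hK (R.hasDeriv t ht) (R.lipschitz_x t ht) (R.boundary_one t ht) hi

/-- The factor `|t - s|` is essential: the projection error enters every time step, and only
contributions proportional to the step length sum to `O(h)`. -/
lemma ritz_increment_sub_le (hK : 0 ≤ K) (R : RegularSolution N f T K u ux ut) {s t : ℝ}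
    (hs : s ∈ Icc 0 T) (ht : t ∈ Icc 0 T) {i : ℕ} (hi : i ≤ M.m) :
    |(ritz N M (fun y => ux y t) i - ritz N M (fun y => ux y s) i) -
      (u (M.x i) t - u (M.x i) s)| ≤ K * |t - s| * M.h := by
  rw [← ritz_sub (continuousOn_of_abs_le hK (R.lipschitz_x t ht))
    (continuousOn_of_abs_le hK (R.lipschitz_x s hs))]
  refine abs_ritz_sub_le (v := fun y => u y t - u y s) (mul_nonneg hK (abs_nonneg _))
    (fun x hx => (R.hasDeriv t ht x hx).sub (R.hasDeriv s hs x hx))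
    (R.lipschitz_diff_x t ht s hs) ?_ hi
  simp [R.boundary_one t ht, R.boundary_one s hs]

/-- One step of the error recursion. -/
lemma error_step (hN : 2 ≤ N) (hK : 0 ≤ K) (hL : 0 ≤ L)
    (hf : ∀ a b, |a| ≤ K + 1 → |b| ≤ K + 1 → |f a - f b| ≤ L * |a - b|)
    (R : RegularSolution N f T K u ux ut) (hG : StepRestriction N M G)
    (H : IsML2Solution N f M G uh) {n : ℕ} (hn : G.time (n + 1) ≤ T) {a : ℝ}
    (ha : K * M.h + a ≤ 1)
    (hθ : ∀ i ≤ M.m, |uh n (M.x i) - ritz N M (fun y => ux y (G.time n)) i| ≤ a) :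
    ∀ i ≤ M.m, |uh (n + 1) (M.x i) - ritz N M (fun y => ux y (G.time (n + 1))) i| ≤
      (1 + L * G.step n) * a + (2 * K + 2 * L * K) * G.step n * (M.h + G.tau) := by
  intro i hi
  have hs := G.step_pos n
  have hsτ := G.step_le_tau n
  have hh := M.h_pos
  have ha0 : 0 ≤ a := (abs_nonneg _).trans (hθ i hi)
  have hstep := G.time_succ n
  have hKL : 0 ≤ 2 * K + 2 * L * K := by positivity
  rcases hi.eq_or_lt with rfl | hi'
  · rw [last_eq_zero (H.mem _), ritz_last, sub_zero, abs_zero]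
    have := G.tau_pos
    positivity
  have ht : G.time n ∈ Icc 0 T := ⟨G.time_nonneg n, by linarith⟩
  have ht' : G.time (n + 1) ∈ Icc 0 T := ⟨G.time_nonneg _, hn⟩
  have hx := M.x_mem hi
  have e1 := scheme_nodal H n hi'
  have e3 := ritz_increment_sub_le (M := M) hK R ht ht' hi
  have e4 := R.taylor_t _ ht (G.time (n + 1)) ⟨by linarith, hn⟩ _ hx
  have e5 := ritz_solution_sub_le (M := M) hK R ht hi
  have hd : G.time (n + 1) - G.time n = G.step n := by linarith
  rw [hd] at e3 e4
  rw [abs_of_pos hs] at e3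
  have hLip : ∀ x ∈ Icc (0 : ℝ) 1, ∀ y ∈ Icc (0 : ℝ) 1,
      |f (u x (G.time n)) - f (u y (G.time n))| ≤ L * K * |x - y| := fun x hx y hy =>
    ((hf _ _ ((R.bound _ ht x hx).trans (by linarith))
      ((R.bound _ ht y hy).trans (by linarith))).trans
      (mul_le_mul_of_nonneg_left (R.lipschitz _ ht x hx y hy) hL)).trans_eq (by ring)
  have e2 := abs_flux_sub_le hN (M := M) (v := fun y => ux y (G.time n))
    (g := fun y => ut y (G.time n) - f (u y (G.time n))) (B := K + L * K) (by positivity)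
    (continuousOn_of_abs_le hK (R.lipschitz_x _ ht))
    (fun x hx y hy => by
      rw [sub_sub_sub_comm, add_mul]
      exact (abs_sub _ _).trans (add_le_add (R.lipschitz_t _ ht x hx y hy) (hLip x hx y hy)))
    (fun x hx => by
      obtain ⟨v₂, h1, h2⟩ := R.equation _ ht x hx
      exact ⟨v₂, h1, by rw [h2]; ring⟩) hi'
  have hμ := mass_pos (N := N) hi'
  have hα : 0 ≤ stiffness N (M.x i) (M.x (i + 1)) := stiffness_nonneg hx.1 (M.x_lt i hi').le
  have hα' : 0 ≤ stiffness N (M.x (i - 1)) (M.x i) :=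
    stiffness_nonneg (M.x_mem (by omega)).1 (M.x_pred_le hi')
  have hsα := (mul_le_mul_of_nonneg_right hsτ (add_nonneg hα' hα)).trans
    (tau_mul_stiffness_le_mass hG hi')
  have e6 : |uh n (M.x i) - u (M.x i) (G.time n)| ≤ a + K * M.h := by
    have := (abs_add_le _ _).trans (add_le_add (hθ i hi) e5)
    rwa [sub_add_sub_cancel] at this
  have hW := R.bound _ ht _ hx
  -- By `ha`, the error at time `n` is at most `1`, so the local Lipschitz constant of `f` applies.
  have hU : |uh n (M.x i)| ≤ K + 1 := by
    have := abs_sub_abs_le_abs_sub (uh n (M.x i)) (u (M.x i) (G.time n))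
    linarith
  have e7 := (hf _ _ hU (hW.trans (by linarith))).trans (mul_le_mul_of_nonneg_left e6 hL)
  -- The four terms of `r` are the nonlinearity at `u_h` against `u`, the lumped flux consistency,
  -- the increment of the projection error and the Taylor remainder in time.
  have conv := abs_le_of_convex_step
    (r := G.step n * (L * (a + K * M.h)) + G.step n * ((K + L * K) * M.h) +
      K * G.step n * M.h + K * G.step n ^ 2)
    (θ' := uh (n + 1) (M.x i) - ritz N M (fun y => ux y (G.time (n + 1))) i)
    hμ hs.le hα hα' hsα (hθ i hi) (hθ (i + 1) hi') (hθ (i - 1) (by omega)) ?_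
  · refine conv.trans ?_
    have : K * G.step n ^ 2 ≤ K * G.step n * G.tau := by
      rw [pow_two, ← mul_assoc]
      exact mul_le_mul_of_nonneg_left hsτ (by positivity)
    have h1 : 0 ≤ K * G.step n * G.tau := (by positivity : 0 ≤ K * G.step n ^ 2).trans this
    have h2 : 0 ≤ L * (K * G.step n * G.tau) := mul_nonneg hL h1
    linear_combination this + h1 + 2 * h2
  · generalize ritz N M (fun y => ux y (G.time (n + 1))) i = P' at *
    generalize ritz N M (fun y => ux y (G.time n)) = P at *
    generalize mass N M i = μ at *
    generalize stiffness N (M.x i) (M.x (i + 1)) = α at *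
    generalize stiffness N (M.x (i - 1)) (M.x i) = α' at *
    generalize G.step n = s at *
    have b1 := mul_le_mul_of_nonneg_left e7 (mul_nonneg hμ.le hs.le)
    have b2 := mul_le_mul_of_nonneg_left e2 hs.le
    have b3 := mul_le_mul_of_nonneg_left e3 hμ.le
    have b4 := mul_le_mul_of_nonneg_left e4 hμ.le
    rw [← abs_of_nonneg (mul_nonneg hμ.le hs.le), ← abs_mul, abs_of_nonneg
      (mul_nonneg hμ.le hs.le)] at b1
    nth_rewrite 1 [← abs_of_nonneg hs.le] at b2
    nth_rewrite 1 [← abs_of_nonneg hμ.le] at b3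
    nth_rewrite 1 [← abs_of_nonneg hμ.le] at b4
    rw [← abs_mul] at b2 b3 b4
    rw [abs_le] at b1 b2 b3 b4 ⊢
    constructor <;> linarith [b1.1, b1.2, b2.1, b2.2, b3.1, b3.2, b4.1, b4.2]

/-- The nodal error bound, by a discrete Gronwall argument. -/
lemma nodal_error (hN : 2 ≤ N) (hK : 0 ≤ K) (hL : 0 ≤ L)
    (hf : ∀ a b, |a| ≤ K + 1 → |b| ≤ K + 1 → |f a - f b| ≤ L * |a - b|)
    (R : RegularSolution N f T K u ux ut) (hG : StepRestriction N M G)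
    (H : IsML2Solution N f M G uh) {A : ℝ} (hA : 0 ≤ A)
    (hsmall : K * M.h + Real.exp (L * T) * (A + (2 * K + 2 * L * K) * T) * (M.h + G.tau) ≤ 1)
    (h0 : ∀ i ≤ M.m, |uh 0 (M.x i) - ritz N M (fun y => ux y 0) i| ≤ A * (M.h + G.tau))
    {n : ℕ} (hn : G.time n ≤ T) {i : ℕ} (hi : i ≤ M.m) :
    |uh n (M.x i) - ritz N M (fun y => ux y (G.time n)) i| ≤
      Real.exp (L * T) * (A + (2 * K + 2 * L * K) * T) * (M.h + G.tau) := by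
  have hδ : 0 < M.h + G.tau := add_pos M.h_pos G.tau_pos
  set c := 2 * K + 2 * L * K with hc
  have hc0 : 0 ≤ c := by positivity
  have mono : ∀ {t : ℝ}, 0 ≤ t → t ≤ T → Real.exp (L * t) * (A + c * t) * (M.h + G.tau) ≤
      Real.exp (L * T) * (A + c * T) * (M.h + G.tau) := by
    intro t ht htT
    have : 0 ≤ A + c * t := by positivity
    gcongr
  -- This bound grows with time, so `hsmall`, stated at time `T`, supplies the smallness that
  -- `error_step` needs at every earlier step.
  suffices key : ∀ n, G.time n ≤ T → ∀ i ≤ M.m,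
      |uh n (M.x i) - ritz N M (fun y => ux y (G.time n)) i| ≤
        Real.exp (L * G.time n) * (A + c * G.time n) * (M.h + G.tau) from
    (key n hn i hi).trans (mono (G.time_nonneg n) hn)
  intro n
  induction n with
  | zero =>
    intro _ i hi
    simpa [TimeGrid.time] using h0 i hi
  | succ n ih =>
    intro hn i hi
    have hs := G.step_pos n
    have hst := G.time_succ n
    have htn := G.time_nonneg n
    have htT : G.time n ≤ T := by linarith
    refine (error_step hN hK hL hf R hG H hn (by linarith [mono htn htT]) (ih htT) i hi).trans ?_
    rw [← hc, hst, mul_add L, Real.exp_add]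
    have h1 : 1 + L * G.step n ≤ Real.exp (L * G.step n) := by
      linarith [Real.add_one_le_exp (L * G.step n)]
    have h2 : 1 ≤ Real.exp (L * G.time n) * Real.exp (L * G.step n) := by
      rw [← Real.exp_add]; exact Real.one_le_exp (by positivity)
    calc _ ≤ Real.exp (L * G.step n) *
            (Real.exp (L * G.time n) * (A + c * G.time n) * (M.h + G.tau)) +
          (Real.exp (L * G.time n) * Real.exp (L * G.step n)) *
            (c * G.step n * (M.h + G.tau)) := by
          refine add_le_add (mul_le_mul_of_nonneg_right h1 (by positivity)) ?_
          exact le_mul_of_one_le_left (by positivity) h2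
      _ = _ := by ring

end Step

/-! ### From nodal values to the maximum norm, and the conclusion -/

/-- A nodal bound for a finite element function extends to all of `[0,1]`. -/
lemma abs_sub_le_of_nodal {M : Mesh} {w v : ℝ → ℝ} {K e : ℝ} (hK : 0 ≤ K) (hw : w ∈ M.space)
    (hv : ∀ x ∈ Icc (0 : ℝ) 1, ∀ y ∈ Icc (0 : ℝ) 1, |v x - v y| ≤ K * |x - y|)
    (he : ∀ i ≤ M.m, |w (M.x i) - v (M.x i)| ≤ e) {y : ℝ} (hy : y ∈ Icc (0 : ℝ) 1) :
    |w y - v y| ≤ e + K * M.h := by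
  obtain ⟨j, hj, hyj⟩ := M.exists_element hy
  have hd := sub_pos.2 (M.x_lt j hj)
  have hh := M.diff_le_h hj
  have near : ∀ i ≤ M.m, |M.x i - y| ≤ M.h → |w (M.x i) - v y| ≤ e + K * M.h := by
    intro i hi hiy
    have := (abs_add_le _ _).trans (add_le_add (he i hi) ((hv _ (M.x_mem hi) y hy).trans
      (mul_le_mul_of_nonneg_left hiy hK)))
    rwa [sub_add_sub_cancel] at this
  have hl := near j hj.le (abs_le.2 ⟨by linarith [hyj.2], by linarith [hyj.1, M.h_pos]⟩)
  have hr := near (j + 1) hj (abs_le.2 ⟨by linarith [hyj.2, M.h_pos], by linarith [hyj.1]⟩)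
  -- A convex combination of the two nodal values of `w`, each within `e + K h` of `v y`.
  have key : w y - v y = ((M.x (j + 1) - y) / (M.x (j + 1) - M.x j)) * (w (M.x j) - v y) +
      ((y - M.x j) / (M.x (j + 1) - M.x j)) * (w (M.x (j + 1)) - v y) := by
    rw [Mesh.space_apply hw hj hyj]
    have := hd.ne'
    field_simp
    ring
  have p1 : 0 ≤ (M.x (j + 1) - y) / (M.x (j + 1) - M.x j) :=
    div_nonneg (sub_nonneg.2 hyj.2) hd.le
  have p2 : 0 ≤ (y - M.x j) / (M.x (j + 1) - M.x j) := div_nonneg (sub_nonneg.2 hyj.1) hd.le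
  have p3 : (M.x (j + 1) - y) / (M.x (j + 1) - M.x j) + (y - M.x j) / (M.x (j + 1) - M.x j) = 1 := by
    rw [← add_div, sub_add_sub_cancel, div_self hd.ne']
  rw [key]
  refine (abs_add_le _ _).trans ?_
  rw [abs_mul, abs_mul, abs_of_nonneg p1, abs_of_nonneg p2]
  calc _ ≤ _ := add_le_add (mul_le_mul_of_nonneg_left hl p1) (mul_le_mul_of_nonneg_left hr p2)
    _ = _ := by rw [← add_mul, p3, one_mul]

/-- Used with `r = K + 1`: `u` is bounded by `K`, and `u_h` is given a margin of `1`. -/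
lemma exists_lipschitz_const {f : ℝ → ℝ} (hf : LocallyLipschitz f) (r : ℝ) :
    ∃ L : ℝ, 0 ≤ L ∧ ∀ a b, |a| ≤ r → |b| ≤ r → |f a - f b| ≤ L * |a - b| := by
  obtain ⟨L, hL⟩ := (hf.locallyLipschitzOn (s := Icc (-r) r)).exists_lipschitzOnWith_of_compact
    isCompact_Icc
  exact ⟨L, L.2, fun a b ha hb => hL.dist_le_mul a (abs_le.1 ha) b (abs_le.1 hb)⟩

end RadialFEM

end

theorem theorem2p6 (N : ℕ) (hN : 2 ≤ N) (f : ℝ → ℝ) (hf : LocallyLipschitz f)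
    (T : ℝ) (hT : 0 < T) (K : ℝ≥0) (C₀ : ℝ) (hC₀ : 0 < C₀) (β : ℝ) (hβ : 0 < β) :
    ∃ C > (0 : ℝ), ∃ h₀ > (0 : ℝ), ∃ τ₀ > (0 : ℝ),
      ∀ (u₀ : ℝ → ℝ) (u : ℝ → ℝ → ℝ),
        ContinuousOn u₀ (Set.Icc 0 1) →
        RadialFEM.IsSmooth T u →
        RadialFEM.IsSolution N f T u₀ u →
        RadialFEM.kappa T u ≤ K →
      ∀ (M : RadialFEM.Mesh) (G : RadialFEM.TimeGrid) (uh : ℕ → ℝ → ℝ),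
        M.QuasiUniform β →
        M.h ≤ h₀ →
        G.tau ≤ τ₀ →
        RadialFEM.StepRestriction N M G →
        RadialFEM.IsML2Solution N f M G uh →
        RadialFEM.supNorm (Set.Icc 0 1) (fun x => uh 0 x - u₀ x)
          ≤ ENNReal.ofReal (C₀ * M.h ^ 2) →
        (⨆ n, ⨆ (_ : G.time n ≤ T),
          RadialFEM.supNorm (Set.Icc 0 1) (fun x => uh n x - u x (G.time n)))
          ≤ ENNReal.ofReal (C * (M.h + G.tau)) := by
  obtain ⟨L, hL, hLip⟩ := RadialFEM.exists_lipschitz_const hf ((K : ℝ) + 1)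
  have hK : (0 : ℝ) ≤ K := K.2
  -- The Gronwall constant of `nodal_error`; `C₀ + K` bounds the initial error, `C₀` from the data
  -- (with `h² ≤ h`) and `K` from the projection.
  set C₁ : ℝ := Real.exp (L * T) * ((C₀ + K) + (2 * K + 2 * L * K) * T) with hC₁
  have hC₁0 : 0 < C₁ := by positivity
  -- Chosen so that `h ≤ 1` and `K h + C₁ (h + τ) ≤ (K + 2 C₁) ε ≤ 1`.
  set ε : ℝ := min 1 (1 / (K + 2 * C₁)) with hε
  have hε0 : 0 < ε := by positivity
  -- One `K` pays for passing from the projection to `u` at the nodes, the other for passing from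
  -- the nodes to all of `[0,1]`.
  refine ⟨C₁ + 2 * K, by positivity, ε, hε0, ε, hε0, ?_⟩
  intro u₀ u hu₀ hs hu hκ M G uh _ hh hτ hG H hinit
  have R := RadialFEM.regularSolution_of_isSolution hf.continuous hT hs hu hκ
  have hhp := M.h_pos
  have hτp := G.tau_pos
  have h1 : M.h ≤ 1 := hh.trans (min_le_left _ _)
  have t0 : (0 : ℝ) ∈ Set.Icc 0 T := ⟨le_rfl, hT.le⟩
  have hεs : (K + 2 * C₁) * ε ≤ 1 := by
    have := mul_le_mul_of_nonneg_left (min_le_right 1 (1 / (K + 2 * C₁)))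
      (by positivity : 0 ≤ K + 2 * C₁)
    rwa [mul_one_div_cancel (by positivity)] at this
  have hsmall : K * M.h + C₁ * (M.h + G.tau) ≤ 1 := by
    linarith [mul_le_mul_of_nonneg_left hh hK, mul_le_mul_of_nonneg_left hh hC₁0.le,
      mul_le_mul_of_nonneg_left hτ hC₁0.le]
  have hstart : ∀ i ≤ M.m,
      |uh 0 (M.x i) - RadialFEM.ritz N M (fun y => RadialFEM.partialX 1 u y 0) i| ≤
        (C₀ + K) * (M.h + G.tau) := by
    intro i hi
    have hx := M.x_mem hi
    have b1 : |uh 0 (M.x i) - u₀ (M.x i)| ≤ C₀ * M.h ^ 2 :=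
      RadialFEM.abs_le_of_supNorm_le (v := fun x => uh 0 x - u₀ x)
        (K := Real.toNNReal (C₀ * M.h ^ 2)) hinit hx |>.trans_eq
          (Real.coe_toNNReal _ (by positivity))
    have b2 := RadialFEM.ritz_solution_sub_le (M := M) hK R t0 hi
    rw [← RadialFEM.initial_Icc hT hu₀ hs hu hx] at b1
    have b3 := (abs_sub _ _).trans (add_le_add b1 b2)
    rw [sub_sub_sub_cancel_right] at b3
    have b4 : C₀ * M.h ^ 2 ≤ C₀ * M.h :=
      mul_le_mul_of_nonneg_left (by rw [pow_two]; exact mul_le_of_le_one_left hhp.le h1) hC₀.le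
    have b5 : 0 ≤ (C₀ + K) * G.tau := by positivity
    linarith
  refine iSup₂_le fun n hn => RadialFEM.supNorm_le_of_abs_le fun y hy => ?_
  have ht : G.time n ∈ Set.Icc 0 T := ⟨G.time_nonneg n, hn⟩
  have nodal : ∀ i ≤ M.m, |uh n (M.x i) - u (M.x i) (G.time n)| ≤
      C₁ * (M.h + G.tau) + K * M.h := by
    intro i hi
    have := (abs_add_le _ _).trans (add_le_add
      (RadialFEM.nodal_error hN hK hL hLip R hG H (by positivity) hsmall hstart hn hi)
      (RadialFEM.ritz_solution_sub_le (M := M) hK R ht hi))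
    rwa [sub_add_sub_cancel] at this
  refine (RadialFEM.abs_sub_le_of_nodal (v := fun y => u y (G.time n)) hK (H.mem n)
    (R.lipschitz _ ht) nodal hy).trans ?_
  have : 0 ≤ K * G.tau := by positivity
  linarith
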